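/- Let $\Theta$ be a topological space with Borel $\sigma$-field $\mathcal B$, let $\mathcal P(\Theta)$ be the set of probability measures on $(\Theta,\mathcal B)$ with the topology of weak convergence, and give $\mathcal P(\Theta)^2$ the product topology. Let $\alpha>0$ and let $P_0\in\mathcal P(\Theta)$ have full support, i.e. its topological support is $\Theta$. Let $v_j$, $j\ge 1$, be i.i.d. $\mathrm{Beta}(1,\alpha)$ and $\theta_j$, $j\ge1$, be i.i.d. $P_0$, with the sequences $(v_j)_j$ and $(\theta_j)_j$ independent of each other. Let $\ell_{j,g}$, $j\ge1$, $g=1,2$, be random variables with values in $\{0,1\}$ such that almost surely $\sum_{j}\ell_{j,g}=\infty$ for $g=1,2$; suppose that the whole array $(\ell_{j,g})$ is independent of $\big((v_j)_j,(\theta_j)_j\big)$ and that, for every $k\in\mathbb N$, $$\mathbb P\big(\ell_{j,1}=1,\ \ell_{j,2}=0 \text{ for } 1\le j\le k,\ \text{ and } \ell_{j,2}=1 \text{ for } k<j\le 2k\big)>0 .$$ Then, almost surely, for $g=1,2$, $$p_g=\sum_{j\ge1}\Big[v_j\ell_{j,g}\prod_{h<j}(1-v_h\ell_{h,g})\Big]\delta_{\theta_j}$$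 is a probability measure, and the vector $p_{1:2}=(p_1,p_2)$ (the thinned dependent Dirichlet process with parameters $\alpha$, $P_0$, $\ell_{1:2}$) has full weak support: the smallest closed subset of $\mathcal P(\Theta)^2$ which contains $p_{1:2}$ with probability one is $\mathcal P(\Theta)^2$ itself. If moreover $\Theta$ is separable and metrizable, then $p_{1:2}$ is (up to a null set) a measurable map into $\mathcal P(\Theta)^2$ with its Borel $\sigma$-field. -/

import Mathlib

open MeasureTheory ProbabilityTheory Set
open scoped ENNReal

noncomputable section

/-- The `j`-th (counting from `0`) thinned stick-breaking weight
`v_j ℓ_j ∏_{h<j} (1 - v_h ℓ_h)`. -/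
def thinnedWeight (v : ℕ → ℝ) (ℓ : ℕ → ℕ) (j : ℕ) : ℝ :=
  v j * (ℓ j : ℝ) * ∏ h ∈ Finset.range j, (1 - v h * (ℓ h : ℝ))

/-- The discrete measure `∑_j v_j ℓ_j ∏_{h<j} (1 - v_h ℓ_h) δ_{θ_j}`. -/
def thinnedMeasure {Θ : Type*} [MeasurableSpace Θ]
    (v : ℕ → ℝ) (θ : ℕ → Θ) (ℓ : ℕ → ℕ) : Measure Θ :=
  Measure.sum fun j => ENNReal.ofReal (thinnedWeight v ℓ j) • Measure.dirac (θ j)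

/-- The ingredients of the stick-breaking construction of a Dirichlet process: `v_j` i.i.d.
`Beta(1, α)` and `θ_j` i.i.d. `P₀`, the two sequences being independent of each other. -/
structure IsStickBreaking {Ω Θ : Type*} [MeasurableSpace Ω] [MeasurableSpace Θ]
    (μ : Measure Ω) (α : ℝ) (P₀ : Measure Θ) (v : ℕ → Ω → ℝ) (θ : ℕ → Ω → Θ) : Prop where
  measurable_v : ∀ j, Measurable (v j)
  measurable_θ : ∀ j, Measurable (θ j)
  law_v : ∀ j, μ.map (v j) = betaMeasure 1 α
  law_θ : ∀ j, μ.map (θ j) = P₀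
  indep_v : iIndepFun v μ
  indep_θ : iIndepFun θ μ
  indep : IndepFun (fun ω j => v j ω) (fun ω j => θ j ω) μ

/-- Random thinning sequences `ℓ_{j,g} ∈ {0,1}` with `∑_j ℓ_{j,g} = ∞` for each group `g`. -/
structure IsThinning {Ω : Type*} [MeasurableSpace Ω] {G : ℕ}
    (μ : Measure Ω) (ℓ : ℕ → Fin G → Ω → ℕ) : Prop where
  measurable : ∀ j g, Measurable (ℓ j g)
  zero_or_one : ∀ᵐ ω ∂μ, ∀ j g, ℓ j g ω = 0 ∨ ℓ j g ω = 1
  sum_eq_top : ∀ᵐ ω ∂μ, ∀ g, ∑' j, (ℓ j g ω : ℝ≥0∞) = ∞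

/-- `p` is the vector of random probability measures built from `v`, `θ` and `ℓ`: almost surely,
`p_g = ∑_j v_j ℓ_{j,g} ∏_{h<j} (1 - v_h ℓ_{h,g}) δ_{θ_j}` for every group `g`. -/
def IsThinnedDDPVector {Ω Θ : Type*} [MeasurableSpace Ω] [MeasurableSpace Θ] {G : ℕ}
    (μ : Measure Ω) (v : ℕ → Ω → ℝ) (θ : ℕ → Ω → Θ) (ℓ : ℕ → Fin G → Ω → ℕ)
    (p : Ω → Fin G → ProbabilityMeasure Θ) : Prop :=
  ∀ᵐ ω ∂μ, ∀ g, (p ω g : Measure Θ) =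
    thinnedMeasure (fun j => v j ω) (fun j => θ j ω) (fun j => ℓ j g ω)

/-- `S` is the weak support of the random vector `p`: the smallest set that is closed for the
product of the topologies of weak convergence and contains `p` with probability one. -/
def IsWeakSupport {Ω Θ : Type*} [MeasurableSpace Ω] [MeasurableSpace Θ] [TopologicalSpace Θ]
    [OpensMeasurableSpace Θ] {G : ℕ} (μ : Measure Ω) (p : Ω → Fin G → ProbabilityMeasure Θ)
    (S : Set (Fin G → ProbabilityMeasure Θ)) : Prop :=
  IsLeast {C | IsClosed C ∧ μ (p ⁻¹' C) = 1} S

end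


/-!
On sequences of fractions that use up the whole stick, the stick-breaking map
`(c, θ) ↦ ∑ⱼ cⱼ ∏_{h<j} (1 - c_h) δ_{θⱼ}` into the probability measures is continuous: the
integral of a bounded continuous function is a limit of partial sums with error at most a multiple
of the residual stick length, which decreases to `0` and hence, by Dini, does so locally uniformly.
Its range is dense, because integrals lie in the closed convex hull of the point evaluations.
Every nonempty weakly open set therefore contains the image of an open box constraining finitely
many fractions and atoms. On the event that the groups use disjoint blocks of sticks, the boxes of
all groups are independent constraints, each of positive probability since `Beta(1, α)` and `P₀`
have full support. That the stick is used up almost surely follows from the expected residual being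
the product of the `1 - 𝔼 cⱼ`.
-/

open Filter Topology BoundedContinuousFunction

section StickBreaking

/-- The length left of a unit stick after breaking off the fraction `c j` of the current remainder
at each step `j < n`. -/
def stickResidual (c : ℕ → ℝ) (n : ℕ) : ℝ :=
  ∏ j ∈ Finset.range n, (1 - c j)

/-- The length of the `j`-th piece broken off a unit stick by the fractions `c`. -/
def stickWeight (c : ℕ → ℝ) (j : ℕ) : ℝ :=
  c j * stickResidual c j

/-- The sequences of fractions which use up the whole stick in the limit. -/
def exhaustingSticks : Set (ℕ → ℝ) :=
  {c | (∀ j, c j ∈ Icc (0 : ℝ) 1) ∧ Tendsto (stickResidual c) atTop (𝓝 0)}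

lemma continuous_stickResidual (n : ℕ) : Continuous fun c => stickResidual c n := by
  unfold stickResidual
  fun_prop

lemma continuous_stickWeight (j : ℕ) : Continuous fun c => stickWeight c j :=
  (continuous_apply j).mul (continuous_stickResidual j)

lemma stickResidual_succ (c : ℕ → ℝ) (n : ℕ) :
    stickResidual c (n + 1) = stickResidual c n * (1 - c n) :=
  Finset.prod_range_succ _ n

lemma sum_range_stickWeight (c : ℕ → ℝ) (n : ℕ) :
    ∑ j ∈ Finset.range n, stickWeight c j = 1 - stickResidual c n := by
  induction n with
  | zero => simp [stickResidual]
  | succ n ih =>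
    rw [Finset.sum_range_succ, ih, stickResidual_succ, stickWeight]
    ring

lemma stickResidual_nonneg {c : ℕ → ℝ} (hc : ∀ j, c j ≤ 1) (n : ℕ) : 0 ≤ stickResidual c n :=
  Finset.prod_nonneg fun j _ => sub_nonneg.2 (hc j)

lemma stickWeight_nonneg {c : ℕ → ℝ} (hc : ∀ j, c j ∈ Icc (0 : ℝ) 1) (j : ℕ) :
    0 ≤ stickWeight c j :=
  mul_nonneg (hc j).1 (stickResidual_nonneg (fun j => (hc j).2) j)

lemma antitone_stickResidual {c : ℕ → ℝ} (hc : ∀ j, c j ∈ Icc (0 : ℝ) 1) :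
    Antitone (stickResidual c) :=
  antitone_nat_of_succ_le fun n => by
    rw [stickResidual_succ]
    exact mul_le_of_le_one_right (stickResidual_nonneg (fun j => (hc j).2) n)
      (sub_le_self 1 (hc n).1)

lemma stickResidual_mem_Icc {c : ℕ → ℝ} (hc : ∀ j, c j ∈ Icc (0 : ℝ) 1) (n : ℕ) :
    stickResidual c n ∈ Icc (0 : ℝ) 1 :=
  ⟨stickResidual_nonneg (fun j => (hc j).2) n,
    (antitone_stickResidual hc n.zero_le).trans_eq (Finset.prod_range_zero _)⟩

lemma hasSum_stickWeight {c : ℕ → ℝ} (hc : c ∈ exhaustingSticks) : HasSum (stickWeight c) 1 := by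
  rw [hasSum_iff_tendsto_nat_of_nonneg (stickWeight_nonneg hc.1)]
  simpa [sum_range_stickWeight] using hc.2.const_sub 1

lemma tendsto_stickResidual_zero_of_not_summable {c : ℕ → ℝ} (hc : ∀ j, c j ∈ Icc (0 : ℝ) 1)
    (hsum : ¬ Summable c) : Tendsto (stickResidual c) atTop (𝓝 0) := by
  have hdiv := (not_summable_iff_tendsto_nat_atTop_of_nonneg fun j => (hc j).1).1 hsum
  refine squeeze_zero (stickResidual_nonneg fun j => (hc j).2) (fun n => ?_)
    (Real.tendsto_exp_neg_atTop_nhds_zero.comp hdiv)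
  calc stickResidual c n ≤ ∏ j ∈ Finset.range n, Real.exp (-c j) :=
        Finset.prod_le_prod (fun j _ => sub_nonneg.2 (hc j).2) fun j _ => Real.one_sub_le_exp_neg _
    _ = Real.exp (-∑ j ∈ Finset.range n, c j) := by
        rw [← Real.exp_sum, Finset.sum_neg_distrib]

lemma exists_mem_exhaustingSticks_stickWeight_eq {w : ℕ → ℝ} (hw : ∀ j, 0 ≤ w j)
    (hsum : HasSum w 1) : ∃ c ∈ exhaustingSticks, stickWeight c = w := by
  let r : ℕ → ℝ := fun n => 1 - ∑ j ∈ Finset.range n, w j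
  have hr_succ (n : ℕ) : r (n + 1) = r n - w n := by
    simp only [r, Finset.sum_range_succ, sub_sub]
  have hr_nonneg (n : ℕ) : 0 ≤ r n := sub_nonneg.2 (sum_le_hasSum _ (fun j _ => hw j) hsum)
  have hwr (n : ℕ) : w n ≤ r n := sub_nonneg.1 (hr_succ n ▸ hr_nonneg (n + 1))
  let c : ℕ → ℝ := fun j => w j / r j
  -- Once the stick is used up, `r j = 0` and `c j` takes the junk value `0`, as it should.
  have hcr (j : ℕ) : c j * r j = w j :=
    div_mul_cancel_of_imp fun h => le_antisymm (h ▸ hwr j) (hw j)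
  have hres : stickResidual c = r := by
    funext n
    induction n with
    | zero => simp [stickResidual, r]
    | succ n ih => rw [stickResidual_succ, ih, hr_succ, ← hcr n]; ring
  refine ⟨c, ⟨fun j => ?_, ?_⟩, funext fun j => ?_⟩
  · exact ⟨div_nonneg (hw j) (hr_nonneg j), div_le_one_of_le₀ (hwr j) (hr_nonneg j)⟩
  · simpa [hres, r] using hsum.tendsto_sum_nat.const_sub 1
  · rw [stickWeight, hres, hcr]

section Delay

variable {c : ℕ → ℝ} {m : ℕ}

lemma stickResidual_add_of_forall_lt_eq_zero (hc : ∀ j < m, c j = 0) (n : ℕ) :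
    stickResidual c (m + n) = stickResidual (fun j => c (m + j)) n := by
  rw [stickResidual, Finset.prod_range_add, Finset.prod_eq_one fun j hj => by
    rw [hc j (Finset.mem_range.1 hj), sub_zero], one_mul, stickResidual]

lemma stickWeight_add_of_forall_lt_eq_zero (hc : ∀ j < m, c j = 0) (j : ℕ) :
    stickWeight c (m + j) = stickWeight (fun j => c (m + j)) j := by
  rw [stickWeight, stickWeight, stickResidual_add_of_forall_lt_eq_zero hc]

lemma mem_exhaustingSticks_of_forall_lt_eq_zero (hc : c ∈ exhaustingSticks)
    (h0 : ∀ j < m, c j = 0) : (fun j => c (m + j)) ∈ exhaustingSticks := by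
  refine ⟨fun j => hc.1 _, ?_⟩
  have hlim := hc.2.comp (tendsto_add_atTop_nat m)
  refine hlim.congr fun n => ?_
  rw [Function.comp_apply, add_comm, stickResidual_add_of_forall_lt_eq_zero h0]

end Delay

lemma measurableSet_exhaustingSticks : MeasurableSet exhaustingSticks := by
  refine MeasurableSet.inter ?_ (measurableSet_tendsto _ fun n =>
    (continuous_stickResidual n).measurable)
  exact MeasurableSet.univ_pi' fun _ => measurableSet_Icc

end StickBreaking

section DiscreteMeasure

variable {ι κ Θ : Type*} [MeasurableSpace Θ]

/-- The measure `∑ᵢ wᵢ δ_{xᵢ}`; the negative ones among the weights `wᵢ` count as zero. -/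
noncomputable def discreteMeasure (w : ι → ℝ) (x : ι → Θ) : Measure Θ :=
  Measure.sum fun i => ENNReal.ofReal (w i) • Measure.dirac (x i)

lemma isProbabilityMeasure_discreteMeasure {w : ι → ℝ} (hw : ∀ i, 0 ≤ w i) (hsum : HasSum w 1)
    (x : ι → Θ) : IsProbabilityMeasure (discreteMeasure w x) := by
  refine ⟨?_⟩
  simp [discreteMeasure, Measure.sum_apply _ MeasurableSet.univ,
    ← ENNReal.ofReal_tsum_of_nonneg hw hsum.summable, hsum.tsum_eq]

lemma discreteMeasure_comp_of_injective {e : ι → κ} (he : e.Injective) {w : κ → ℝ}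
    (hw : Function.support w ⊆ range e) (x : κ → Θ) :
    discreteMeasure (w ∘ e) (x ∘ e) = discreteMeasure w x := by
  ext s hs
  simp only [discreteMeasure, Measure.sum_apply _ hs, Measure.smul_apply, smul_eq_mul]
  refine he.tsum_eq (f := fun k => ENNReal.ofReal (w k) * Measure.dirac (x k) s) fun k hk => hw ?_
  rintro (hwk : w k = 0)
  simp [hwk] at hk

lemma hasSum_integral_discreteMeasure {w : ι → ℝ} (hw : ∀ i, 0 ≤ w i) (x : ι → Θ) {f : Θ → ℝ}
    (hf : Measurable f) (hfi : Integrable f (discreteMeasure w x)) :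
    HasSum (fun i => w i * f (x i)) (∫ y, f y ∂discreteMeasure w x) := by
  have h := hasSum_integral_measure hfi
  simp only [integral_smul_measure, integral_dirac' _ _ hf.stronglyMeasurable,
    ENNReal.toReal_ofReal (hw _), smul_eq_mul] at h
  exact h

end DiscreteMeasure

section StickBreakingMeasure

variable {Θ : Type*} [MeasurableSpace Θ]

/-- The probability measure `∑ⱼ cⱼ ∏_{h<j} (1 - c_h) δ_{θⱼ}`. -/
noncomputable def stickBreaking (c : exhaustingSticks) (θ : ℕ → Θ) : ProbabilityMeasure Θ :=
  ⟨discreteMeasure (stickWeight c) θ, isProbabilityMeasure_discreteMeasure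
    (stickWeight_nonneg c.2.1) (hasSum_stickWeight c.2) θ⟩

lemma coe_stickBreaking (c : exhaustingSticks) (θ : ℕ → Θ) :
    (stickBreaking c θ : Measure Θ) = discreteMeasure (stickWeight c) θ :=
  rfl

lemma coe_stickBreaking_eq_thinnedMeasure {c : exhaustingSticks} {v : ℕ → ℝ} {ℓ : ℕ → ℕ}
    (hc : (c : ℕ → ℝ) = fun j => v j * ℓ j) (θ : ℕ → Θ) :
    (stickBreaking c θ : Measure Θ) = thinnedMeasure v θ ℓ := by
  rw [coe_stickBreaking, hc]
  rfl

lemma stickBreaking_eq_of_forall_lt_eq_zero {c : exhaustingSticks} {m : ℕ}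
    (hc : ∀ j < m, (c : ℕ → ℝ) j = 0) (θ : ℕ → Θ) :
    stickBreaking c θ = stickBreaking
      ⟨_, mem_exhaustingSticks_of_forall_lt_eq_zero c.2 hc⟩ (fun j => θ (m + j)) := by
  have hsupp : Function.support (stickWeight c) ⊆ range (m + ·) := fun j hj => by
    have hmj : m ≤ j := not_lt.1 fun hjm => hj (by simp [stickWeight, hc j hjm])
    exact ⟨j - m, Nat.add_sub_of_le hmj⟩
  refine Subtype.ext ((discreteMeasure_comp_of_injective (add_right_injective m) hsupp θ).symm.trans
    ?_)
  congr 1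
  exact funext (stickWeight_add_of_forall_lt_eq_zero hc)

lemma exists_stickBreaking_eq_discreteMeasure {ι : Type*} [Countable ι] {w : ι → ℝ}
    (hw : ∀ i, 0 ≤ w i) (hsum : HasSum w 1) (x : ι → Θ) :
    ∃ (c : exhaustingSticks) (θ : ℕ → Θ), (stickBreaking c θ : Measure Θ) =
      discreteMeasure w x := by
  obtain ⟨e, he⟩ := exists_injective_nat ι
  have : Nonempty ι := by
    by_contra! hι
    exact zero_ne_one (hasSum_empty.unique hsum)
  let w' : ℕ → ℝ := Function.extend e w 0
  have hw' (j : ℕ) : 0 ≤ w' j := by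
    by_cases hj : ∃ i, e i = j
    · obtain ⟨i, rfl⟩ := hj
      simpa only [w', he.extend_apply] using hw i
    · exact (Function.extend_apply' w (0 : ℕ → ℝ) j hj).ge
  obtain ⟨c, hc, hcw⟩ := exists_mem_exhaustingSticks_stickWeight_eq hw'
    ((hasSum_extend_zero he).2 hsum)
  refine ⟨⟨c, hc⟩, x ∘ Function.invFun e, ?_⟩
  have hsupp : Function.support w' ⊆ range e := fun j hj => by
    by_contra hje
    exact hj (Function.extend_apply' w (0 : ℕ → ℝ) j hje)
  rw [coe_stickBreaking, hcw, ← discreteMeasure_comp_of_injective he hsupp, Function.extend_comp he,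
    Function.comp_assoc, Function.invFun_comp he, Function.comp_id]

variable [TopologicalSpace Θ] [OpensMeasurableSpace Θ]

lemma abs_integral_stickBreaking_sub_sum_le (c : exhaustingSticks) (θ : ℕ → Θ) (f : Θ →ᵇ ℝ)
    (n : ℕ) :
    |∫ x, f x ∂(stickBreaking c θ : Measure Θ) -
      ∑ j ∈ Finset.range n, stickWeight c j * f (θ j)| ≤ ‖f‖ * stickResidual c n := by
  have hw := stickWeight_nonneg c.2.1
  have htail_f := (hasSum_nat_add_iff' n).2 <| hasSum_integral_discreteMeasure hw θ
    f.continuous.measurable (f.integrable (stickBreaking c θ : Measure Θ))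
  have htail := (hasSum_nat_add_iff' n).2 (hasSum_stickWeight c.2)
  rw [sum_range_stickWeight, sub_sub_cancel] at htail
  rw [coe_stickBreaking, ← htail_f.tsum_eq]
  refine tsum_of_norm_bounded (f := fun j => stickWeight c (j + n) * f (θ (j + n)))
    (htail.mul_left ‖f‖) fun j => ?_
  rw [norm_mul, Real.norm_of_nonneg (hw _), mul_comm]
  exact mul_le_mul_of_nonneg_right (f.norm_coe_le_norm _) (hw _)

lemma continuous_stickBreaking {X : Type*} [TopologicalSpace X] {c : X → exhaustingSticks}
    {θ : X → ℕ → Θ} (hc : Continuous c) (hθ : Continuous θ) :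
    Continuous fun x => stickBreaking (c x) (θ x) := by
  rw [ProbabilityMeasure.continuous_iff_forall_continuous_integral]
  intro f
  have hc' : Continuous fun x => (c x : ℕ → ℝ) := continuous_subtype_val.comp hc
  let R : ℕ → X → ℝ := fun n x => ‖f‖ * stickResidual (c x) n
  have hR : TendstoLocallyUniformly R 0 atTop := by
    refine Antitone.tendstoLocallyUniformly_of_forall_tendsto (fun n => ?_) (fun m n hmn x => ?_)
      continuous_zero fun x => by simpa [R] using (c x).2.2.const_mul ‖f‖
    · exact ((continuous_stickResidual n).comp hc').const_mul _
    · exact mul_le_mul_of_nonneg_left (antitone_stickResidual (c x).2.1 hmn) (norm_nonneg f)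
  have hS : TendstoLocallyUniformly
      (fun n x => ∑ j ∈ Finset.range n, stickWeight (c x) j * f (θ x j))
      (fun x => ∫ y, f y ∂(stickBreaking (c x) (θ x) : Measure Θ)) atTop := by
    rw [Metric.tendstoLocallyUniformly_iff] at hR ⊢
    intro ε hε x
    obtain ⟨t, ht, htR⟩ := hR ε hε x
    refine ⟨t, ht, htR.mono fun n hn y hy => ?_⟩
    have hRn : R n y < ε := (le_abs_self _).trans_lt (by simpa [Real.dist_eq] using hn y hy)
    exact (abs_integral_stickBreaking_sub_sum_le (c y) (θ y) f n).trans_lt hRn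
  refine hS.continuous (Frequently.of_forall fun n => continuous_finsetSum _ fun j _ => ?_)
  exact ((continuous_stickWeight j).comp hc').mul (by fun_prop)

end StickBreakingMeasure

section WeakTopology

variable {Θ : Type*} [MeasurableSpace Θ] [TopologicalSpace Θ] [OpensMeasurableSpace Θ]

lemma isInducing_integral_boundedContinuousFunction :
    IsInducing fun (P : ProbabilityMeasure Θ) (f : Θ →ᵇ ℝ) => ∫ x, f x ∂(P : Measure Θ) := by
  refine isInducing_iff_nhds.2 fun P => le_antisymm (Tendsto.le_comap ?_) ?_
  · exact tendsto_pi_nhds.2 (ProbabilityMeasure.tendsto_iff_forall_integral_tendsto.1 tendsto_id)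
  · exact tendsto_id'.1 <| ProbabilityMeasure.tendsto_iff_forall_integral_tendsto.2
      (tendsto_pi_nhds.1 tendsto_comap)

lemma mem_closure_of_forall_finset_integral_mem_closure {A : Set (ProbabilityMeasure Θ)}
    {P : ProbabilityMeasure Θ}
    (h : ∀ s : Finset (Θ →ᵇ ℝ), (fun f : s => ∫ x, f.1 x ∂(P : Measure Θ)) ∈
      closure ((fun (Q : ProbabilityMeasure Θ) (f : s) => ∫ x, f.1 x ∂(Q : Measure Θ)) '' A)) :
    P ∈ closure A := by
  rw [isInducing_integral_boundedContinuousFunction.closure_eq_preimage_closure_image, mem_preimage,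
    mem_closure_iff]
  intro W hW hPW
  obtain ⟨s, u, hu, hsub⟩ := isOpen_pi_iff.1 hW _ hPW
  obtain ⟨_, hy, Q, hQ, rfl⟩ := mem_closure_iff.1 (h s) (univ.pi fun f : s => u f)
    (isOpen_set_pi finite_univ fun f _ => (hu f f.2).1) fun f _ => (hu f f.2).2
  exact ⟨_, hsub fun f hf => hy ⟨f, hf⟩ (mem_univ _), mem_image_of_mem _ hQ⟩

lemma denseRange_stickBreaking :
    DenseRange fun q : exhaustingSticks × (ℕ → Θ) => stickBreaking q.1 q.2 := by
  refine fun P => mem_closure_of_forall_finset_integral_mem_closure fun s => ?_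
  let F : Θ → s → ℝ := fun x f => f.1 x
  have hP : (fun f : s => ∫ x, f.1 x ∂(P : Measure Θ)) ∈ closure (convexHull ℝ (range F)) := by
    have hF : ∫ x, F x ∂(P : Measure Θ) = fun f => ∫ x, f.1 x ∂(P : Measure Θ) :=
      funext (eval_integral fun f => f.1.integrable _)
    rw [← hF]
    exact (convex_convexHull ℝ _).closure.integral_mem isClosed_closure
      (ae_of_all _ fun x => subset_closure (subset_convexHull ℝ _ (mem_range_self x)))
      (Integrable.of_eval fun f => f.1.integrable _)
  refine closure_mono (fun y hy => ?_) hP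
  obtain ⟨ι, _, w, z, hw, hw1, hz, rfl⟩ := mem_convexHull_iff_exists_fintype.1 hy
  choose x hx using hz
  obtain ⟨c, θ, hcθ⟩ := exists_stickBreaking_eq_discreteMeasure hw (hw1 ▸ hasSum_fintype w) x
  refine ⟨_, mem_range_self (c, θ), funext fun f => ?_⟩
  have hsum := hasSum_integral_discreteMeasure hw x f.1.continuous.measurable
    (hcθ ▸ f.1.integrable _)
  change ∫ y, f.1 y ∂(stickBreaking c θ : Measure Θ) = _
  rw [hcθ, hsum.unique (hasSum_fintype _)]
  simp [← hx, F]

lemma exists_isOpen_cylinder_subset {X : Type*} [TopologicalSpace X] {W : Set (ℕ → X)}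
    (hW : IsOpen W) {x : ℕ → X} (hx : x ∈ W) :
    ∃ (n : ℕ) (V : ℕ → Set X), (∀ j, IsOpen (V j) ∧ x j ∈ V j) ∧
      ∀ y : ℕ → X, (∀ j < n, y j ∈ V j) → y ∈ W := by
  classical
  obtain ⟨s, u, hu, hsub⟩ := isOpen_pi_iff.1 hW x hx
  obtain ⟨n, hn⟩ := s.exists_nat_subset_range
  refine ⟨n, fun j => if j ∈ s then u j else univ, fun j => ?_, fun y hy => hsub fun j hj => ?_⟩
  · by_cases hj : j ∈ s
    · simpa only [hj, if_true] using hu j hj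
    · simp [hj]
  · simpa only [Finset.mem_coe.1 hj, if_true] using hy j (Finset.mem_range.1 (hn hj))

lemma exists_isOpen_box_stickBreaking_mem {U : Set (ProbabilityMeasure Θ)} (hU : IsOpen U)
    (hne : U.Nonempty) :
    ∃ (n : ℕ) (V : ℕ → Set ℝ) (T : ℕ → Set Θ),
      (∀ j, IsOpen (V j) ∧ (V j ∩ Icc 0 1).Nonempty) ∧ (∀ j, IsOpen (T j) ∧ (T j).Nonempty) ∧
      ∀ (c : exhaustingSticks) (θ : ℕ → Θ), (∀ j < n, (c : ℕ → ℝ) j ∈ V j ∧ θ j ∈ T j) →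
        stickBreaking c θ ∈ U := by
  obtain ⟨⟨c₀, θ₀⟩, hU₀⟩ := denseRange_stickBreaking.exists_mem_open hU hne
  obtain ⟨A, B, hA, hB, hcA, hθB, hAB⟩ := isOpen_prod_iff.1
    (hU.preimage (continuous_stickBreaking continuous_fst continuous_snd)) c₀ θ₀ hU₀
  obtain ⟨W, hW, hWA⟩ := isOpen_induced_iff.1 hA
  obtain ⟨n, V, hV, hVW⟩ := exists_isOpen_cylinder_subset hW (hWA.ge hcA)
  obtain ⟨m, T, hT, hTB⟩ := exists_isOpen_cylinder_subset hB hθB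
  refine ⟨max n m, V, T, fun j => ⟨(hV j).1, _, (hV j).2, c₀.2.1 j⟩,
    fun j => ⟨(hT j).1, _, (hT j).2⟩, fun c θ h => @hAB (c, θ) ⟨?_, ?_⟩⟩
  · exact hWA.le <| hVW c fun j hj => (h j (lt_max_of_lt_left hj)).1
  · exact hTB _ fun j hj => (h j (lt_max_of_lt_right hj)).2

end WeakTopology

section Beta

variable {a b : ℝ}

lemma measurable_betaPDF (a b : ℝ) : Measurable (betaPDF a b) :=
  (measurable_betaPDFReal a b).ennreal_ofReal

lemma ae_betaMeasure_mem_Ioo (a b : ℝ) : ∀ᵐ x ∂betaMeasure a b, x ∈ Ioo (0 : ℝ) 1 := by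
  rw [betaMeasure, ae_withDensity_iff (measurable_betaPDF a b)]
  refine ae_of_all _ fun x hx => ?_
  contrapose! hx
  rw [betaPDF_eq, if_neg (mem_Ioo.not.1 hx), ENNReal.ofReal_zero]

lemma support_betaMeasure (ha : 0 < a) (hb : 0 < b) : (betaMeasure a b).support = Icc 0 1 := by
  refine Subset.antisymm (Measure.support_subset_of_isClosed isClosed_Icc
    ((ae_betaMeasure_mem_Ioo a b).mono fun x hx => Ioo_subset_Icc_self hx)) fun x hx => ?_
  rw [Measure.mem_support_iff_forall]
  intro V hV
  rw [← closure_Ioo zero_ne_one] at hx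
  have hvol : 0 < volume (interior V ∩ Ioo (0 : ℝ) 1) :=
    (isOpen_interior.inter isOpen_Ioo).measure_pos _
      (mem_closure_iff.1 hx _ isOpen_interior (mem_interior_iff_mem_nhds.2 hV))
  refine pos_iff_ne_zero.2 fun h0 => hvol.ne' ?_
  rw [betaMeasure, withDensity_apply_eq_zero (measurable_betaPDF a b)] at h0
  refine measure_mono_null (fun y hy => ?_) h0
  exact ⟨(ENNReal.ofReal_pos.2 (betaPDFReal_pos hy.2.1 hy.2.2 ha hb)).ne', interior_subset hy.1⟩

end Beta

section IID

variable {ι κ Ω β : Type*} [MeasurableSpace Ω] [MeasurableSpace β]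

/-- The random variables `X i` are independent with common law `ν`. -/
structure IsIID (μ : Measure Ω) (ν : Measure β) (X : ι → Ω → β) : Prop where
  measurable : ∀ i, Measurable (X i)
  law : ∀ i, μ.map (X i) = ν
  indep : iIndepFun X μ

variable {μ : Measure Ω} {ν : Measure β} {X : ι → Ω → β}

lemma IsIID.precomp (hX : IsIID μ ν X) {e : κ → ι} (he : e.Injective) :
    IsIID μ ν fun k => X (e k) :=
  ⟨fun _ => hX.measurable _, fun _ => hX.law _, hX.indep.precomp he⟩

lemma IsIID.measure_forall_mem_pos [Finite ι] [TopologicalSpace β] [OpensMeasurableSpace β]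
    (hX : IsIID μ ν X) {V : ι → Set β}
    (hV : ∀ i, IsOpen (V i) ∧ (V i ∩ ν.support).Nonempty) :
    0 < μ {ω | ∀ i, X i ω ∈ V i} := by
  have := Fintype.ofFinite ι
  have hprod := hX.indep.measure_inter_preimage_eq_mul Finset.univ
    fun i _ => (hV i).1.measurableSet
  simp only [Finset.mem_univ, iInter_true] at hprod
  rw [ofPred_forall]
  refine hprod.symm ▸ pos_iff_ne_zero.2 (Finset.prod_ne_zero_iff.2 fun i _ => ?_)
  rw [← Measure.map_apply (hX.measurable i) (hV i).1.measurableSet, hX.law]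
  obtain ⟨x, hxV, hx⟩ := (hV i).2
  exact ((Measure.mem_support_iff_forall x).1 hx _ ((hV i).1.mem_nhds hxV)).ne'

lemma IsStickBreaking.isIID_v {Θ : Type*} [MeasurableSpace Θ] {α : ℝ} {P₀ : Measure Θ}
    {v : ℕ → Ω → ℝ} {θ : ℕ → Ω → Θ} (h : IsStickBreaking μ α P₀ v θ) :
    IsIID μ (betaMeasure 1 α) v :=
  ⟨h.measurable_v, h.law_v, h.indep_v⟩

lemma IsStickBreaking.isIID_θ {Θ : Type*} [MeasurableSpace Θ] {α : ℝ} {P₀ : Measure Θ}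
    {v : ℕ → Ω → ℝ} {θ : ℕ → Ω → Θ} (h : IsStickBreaking μ α P₀ v θ) : IsIID μ P₀ θ :=
  ⟨h.measurable_θ, h.law_θ, h.indep_θ⟩

end IID

section Exhaustion

variable {Ω : Type*} [MeasurableSpace Ω] {μ : Measure Ω}

lemma integral_stickResidual_of_iIndepFun [IsProbabilityMeasure μ] {c : ℕ → Ω → ℝ}
    (hc : ∀ j, Integrable (c j) μ) (hind : iIndepFun c μ) (n : ℕ) :
    ∫ ω, stickResidual (fun j => c j ω) n ∂μ = stickResidual (fun j => ∫ ω, c j ω ∂μ) n := by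
  simp only [stickResidual, Finset.prod_range]
  rw [(hind.precomp Fin.val_injective).integral_fun_prod_comp (f := fun _ x => 1 - x)
    (fun i => (hc i).aemeasurable) fun i => by fun_prop]
  simp [integral_sub (integrable_const _) (hc _)]

lemma ae_mem_exhaustingSticks_of_not_summable_integral [IsProbabilityMeasure μ] {c : ℕ → Ω → ℝ}
    (hc : ∀ j, Measurable (c j)) (h01 : ∀ᵐ ω ∂μ, ∀ j, c j ω ∈ Icc (0 : ℝ) 1)
    (hind : iIndepFun c μ) (hsum : ¬ Summable fun j => ∫ ω, c j ω ∂μ) :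
    ∀ᵐ ω ∂μ, (fun j => c j ω) ∈ exhaustingSticks := by
  have hci (j : ℕ) : Integrable (c j) μ :=
    Integrable.of_mem_Icc 0 1 (hc j).aemeasurable (h01.mono fun ω h => h j)
  have hmean (j : ℕ) : ∫ ω, c j ω ∂μ ∈ Icc (0 : ℝ) 1 :=
    (convex_Icc 0 1).integral_mem isClosed_Icc (h01.mono fun ω h => h j) (hci j)
  have hres : ∀ᵐ ω ∂μ, Tendsto (stickResidual fun j => c j ω) atTop (𝓝 0) := by
    refine tendsto_of_integral_tendsto_of_antitone (F := fun _ => 0) (fun n => ?_)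
      (integrable_zero _ _ _) ?_ (h01.mono fun ω h => antitone_stickResidual h)
      (h01.mono fun ω h => stickResidual_nonneg fun j => (h j).2)
    · have hmeas : Measurable fun ω => stickResidual (fun j => c j ω) n :=
        (continuous_stickResidual n).measurable.comp (measurable_pi_lambda _ hc)
      exact Integrable.of_mem_Icc 0 1 hmeas.aemeasurable
        (h01.mono fun ω h => stickResidual_mem_Icc h n)
    · simpa only [integral_stickResidual_of_iIndepFun hci hind, integral_zero] using
        tendsto_stickResidual_zero_of_not_summable hmean hsum
  filter_upwards [h01, hres] with ω h h' using ⟨h, h'⟩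

lemma not_summable_natCast_of_tsum_eq_top {l : ℕ → ℕ} (hl : ∑' j, (l j : ℝ≥0∞) = ∞) :
    ¬ Summable fun j => (l j : ℝ) := by
  intro h
  refine (ENNReal.tsum_coe_ne_top_iff_summable (f := fun j => (l j : NNReal))).2 ?_ (by simpa)
  exact NNReal.summable_coe.1 (by simpa using h)

lemma IsIID.ae_mul_mem_exhaustingSticks [IsProbabilityMeasure μ] {ν : Measure ℝ}
    {v : ℕ → Ω → ℝ} (hv : IsIID μ ν v) (h01 : ∀ᵐ x ∂ν, x ∈ Icc (0 : ℝ) 1)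
    (hmean : 0 < ∫ x, x ∂ν) {l : ℕ → ℕ} (hl : ∀ j, l j = 0 ∨ l j = 1)
    (hsum : ∑' j, (l j : ℝ≥0∞) = ∞) :
    ∀ᵐ ω ∂μ, (fun j => v j ω * l j) ∈ exhaustingSticks := by
  refine ae_mem_exhaustingSticks_of_not_summable_integral (fun j => (hv.measurable j).mul_const _)
    (ae_all_iff.2 fun j => ?_) (hv.indep.comp (fun j x => x * l j) fun j => by fun_prop) ?_
  · have hvj : ∀ᵐ ω ∂μ, v j ω ∈ Icc (0 : ℝ) 1 :=
      ae_of_ae_map (hv.measurable j).aemeasurable (hv.law j ▸ h01)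
    filter_upwards [hvj] with ω hω
    rcases hl j with h | h <;> simp_all
  · have hvj (j : ℕ) : ∫ ω, v j ω * l j ∂μ = (∫ x, x ∂ν) * l j := by
      rw [integral_mul_const, ← hv.law j,
        integral_map (hv.measurable j).aemeasurable (by fun_prop)]
    simpa only [hvj, summable_mul_left_iff hmean.ne'] using
      not_summable_natCast_of_tsum_eq_top hsum

lemma ae_prodMk_mem_of_indepFun [IsFiniteMeasure μ] {β γ : Type*} [MeasurableSpace β]
    [MeasurableSpace γ] {X : Ω → β} {Y : Ω → γ} (hX : Measurable X) (hY : Measurable Y)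
    (hXY : IndepFun X Y μ) {S : Set (β × γ)} (hS : MeasurableSet S)
    (h : ∀ᵐ ω ∂μ, ∀ᵐ ω' ∂μ, (X ω, Y ω') ∈ S) : ∀ᵐ ω ∂μ, (X ω, Y ω) ∈ S := by
  refine ae_of_ae_map (hX.prodMk hY).aemeasurable ?_
  rw [(indepFun_iff_map_prod_eq_prod_map_map hX.aemeasurable hY.aemeasurable).1 hXY]
  refine (Measure.ae_prod_iff_ae_ae hS).2 ?_
  have hslice (x : β) : (∀ᵐ y ∂μ.map Y, (x, y) ∈ S) ↔ ∀ᵐ ω' ∂μ, (x, Y ω') ∈ S :=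
    ae_map_iff hY.aemeasurable (measurable_prodMk_left hS)
  refine (ae_map_iff hX.aemeasurable ?_).2 (h.mono fun ω hω => (hslice _).2 hω)
  exact measurable_measure_prodMk_left hS.compl (measurableSet_singleton 0)

lemma integral_id_pos_of_mem_support {ν : Measure ℝ} (hint : Integrable (fun x => x) ν)
    (h0 : ∀ᵐ x ∂ν, 0 ≤ x) {a : ℝ} (ha : a ∈ ν.support) (ha0 : a ≠ 0) : 0 < ∫ x, x ∂ν := by
  rw [integral_pos_iff_support_of_nonneg_ae h0 hint]
  exact (Measure.mem_support_iff_forall a).1 ha _ (isOpen_ne.mem_nhds ha0)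

lemma IsThinning.ae_mul_mem_exhaustingSticks [IsProbabilityMeasure μ] {ν : Measure ℝ}
    (hν : ν.support = Icc 0 1) {v : ℕ → Ω → ℝ} (hv : IsIID μ ν v) {G : ℕ}
    {ℓ : ℕ → Fin G → Ω → ℕ} (hℓ : IsThinning μ ℓ)
    (hind : IndepFun (fun ω j g => ℓ j g ω) (fun ω j => v j ω) μ) (g : Fin G) :
    ∀ᵐ ω ∂μ, (fun j => v j ω * ℓ j g ω) ∈ exhaustingSticks := by
  have h01 : ∀ᵐ x ∂ν, x ∈ Icc (0 : ℝ) 1 := hν ▸ Measure.support_mem_ae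
  have : IsProbabilityMeasure ν :=
    hv.law 0 ▸ Measure.isProbabilityMeasure_map (hv.measurable 0).aemeasurable
  have hmean : 0 < ∫ x, x ∂ν :=
    integral_id_pos_of_mem_support (Integrable.of_mem_Icc 0 1 aemeasurable_id h01)
      (h01.mono fun x hx => hx.1) (hν ▸ right_mem_Icc.2 zero_le_one) one_ne_zero
  let S : Set ((ℕ → Fin G → ℕ) × (ℕ → ℝ)) :=
    (fun q j => q.2 j * (q.1 j g : ℝ)) ⁻¹' exhaustingSticks
  have hS : MeasurableSet S := measurableSet_exhaustingSticks.preimage (by fun_prop)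
  refine ae_prodMk_mem_of_indepFun
    (measurable_pi_lambda _ fun j => measurable_pi_lambda _ (hℓ.measurable j))
    (measurable_pi_lambda _ hv.measurable) hind hS ?_
  filter_upwards [hℓ.zero_or_one, hℓ.sum_eq_top] with ω hl hsum
  exact hv.ae_mul_mem_exhaustingSticks h01 hmean (fun j => hl j g) (hsum g)

lemma exists_measurable_subtype_ae_eq [NeZero μ] {β : Type*} [MeasurableSpace β] {s : Set β}
    {X : Ω → β} (hX : AEMeasurable X μ) (hs : ∀ᵐ ω ∂μ, X ω ∈ s) :
    ∃ Y : Ω → s, Measurable Y ∧ ∀ᵐ ω ∂μ, (Y ω : β) = X ω := by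
  obtain ⟨ω₀, hω₀⟩ := hs.exists
  obtain ⟨Y, hY, hYs, hXY⟩ := hX.exists_ae_eq_range_subset hs ⟨_, hω₀⟩
  exact ⟨fun ω => ⟨Y ω, hYs (mem_range_self ω)⟩, hY.subtype_mk, hXY.symm⟩

lemma IsThinning.exists_measurable_exhaustingSticks [IsProbabilityMeasure μ] {ν : Measure ℝ}
    (hν : ν.support = Icc 0 1) {v : ℕ → Ω → ℝ} (hv : IsIID μ ν v) {G : ℕ}
    {ℓ : ℕ → Fin G → Ω → ℕ} (hℓ : IsThinning μ ℓ)
    (hind : IndepFun (fun ω j g => ℓ j g ω) (fun ω j => v j ω) μ) :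
    ∃ c : Ω → Fin G → exhaustingSticks, Measurable c ∧
      ∀ᵐ ω ∂μ, ∀ g, (c ω g : ℕ → ℝ) = fun j => v j ω * ℓ j g ω := by
  have hmeas (g : Fin G) : Measurable fun ω j => v j ω * (ℓ j g ω : ℝ) :=
    measurable_pi_lambda _ fun j =>
      (hv.measurable j).mul (measurable_from_nat.comp (hℓ.measurable j g))
  choose c hc hcv using fun g => exists_measurable_subtype_ae_eq (hmeas g).aemeasurable
    (hℓ.ae_mul_mem_exhaustingSticks hν hv hind g)
  exact ⟨fun ω g => c g ω, measurable_pi_lambda _ hc, ae_all_iff.2 hcv⟩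

end Exhaustion

section Support

variable {Ω : Type*} [MeasurableSpace Ω] {μ : Measure Ω}

lemma measure_inter_forall_mem_pos {ι β X Y : Type*} [Finite ι] [MeasurableSpace β]
    [MeasurableSpace X] [TopologicalSpace X] [OpensMeasurableSpace X] [MeasurableSpace Y]
    [TopologicalSpace Y] [OpensMeasurableSpace Y] {ν : Measure X} {ρ : Measure Y} {x : ι → Ω → X}
    {y : ι → Ω → Y} {b : Ω → β} (hx : IsIID μ ν x) (hy : IsIID μ ρ y)
    (hxy : IndepFun (fun ω i => x i ω) (fun ω i => y i ω) μ)
    (hb : IndepFun b (fun ω => (fun i => x i ω, fun i => y i ω)) μ) {S : Set β}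
    (hS : MeasurableSet S) (hbS : 0 < μ (b ⁻¹' S)) {V : ι → Set X} {T : ι → Set Y}
    (hV : ∀ i, IsOpen (V i) ∧ (V i ∩ ν.support).Nonempty)
    (hT : ∀ i, IsOpen (T i) ∧ (T i ∩ ρ.support).Nonempty) :
    0 < μ (b ⁻¹' S ∩ {ω | ∀ i, x i ω ∈ V i ∧ y i ω ∈ T i}) := by
  have hVm : MeasurableSet {a : ι → X | ∀ i, a i ∈ V i} :=
    MeasurableSet.univ_pi' fun i => (hV i).1.measurableSet
  have hTm : MeasurableSet {a : ι → Y | ∀ i, a i ∈ T i} :=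
    MeasurableSet.univ_pi' fun i => (hT i).1.measurableSet
  have hbox : {ω | ∀ i, x i ω ∈ V i ∧ y i ω ∈ T i} =
      (fun ω => (fun i => x i ω, fun i => y i ω)) ⁻¹'
        ({a | ∀ i, a i ∈ V i} ×ˢ {a | ∀ i, a i ∈ T i}) := by
    ext ω
    exact forall_and
  have hboxpos : 0 < μ {ω | ∀ i, x i ω ∈ V i ∧ y i ω ∈ T i} := by
    simp only [forall_and]
    refine (ENNReal.mul_pos (hx.measure_forall_mem_pos hV).ne'
      (hy.measure_forall_mem_pos hT).ne').trans_eq ?_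
    exact (hxy.measure_inter_preimage_eq_mul _ _ hVm hTm).symm
  rw [hbox] at hboxpos ⊢
  rw [hb.measure_inter_preimage_eq_mul _ _ hS (hVm.prod hTm)]
  exact ENNReal.mul_pos hbS.ne' hboxpos.ne'

lemma isWeakSupport_univ_of_forall_isOpen [IsProbabilityMeasure μ] {Θ : Type*} [MeasurableSpace Θ]
    [TopologicalSpace Θ] [OpensMeasurableSpace Θ] {G : ℕ} {p : Ω → Fin G → ProbabilityMeasure Θ}
    (h : ∀ U : Fin G → Set (ProbabilityMeasure Θ), (∀ g, IsOpen (U g) ∧ (U g).Nonempty) →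
      ∃ E, MeasurableSet E ∧ 0 < μ E ∧ ∀ᵐ ω ∂μ, ω ∈ E → ∀ g, p ω g ∈ U g) :
    IsWeakSupport μ p univ := by
  refine ⟨⟨isClosed_univ, by simp⟩, fun C ⟨hC, hCp⟩ q _ => ?_⟩
  by_contra hq
  obtain ⟨U, hU, hUC⟩ := isOpen_pi_iff'.1 hC.isOpen_compl q hq
  obtain ⟨E, hEm, hE, hEU⟩ := h U fun g => ⟨(hU g).1, _, (hU g).2⟩
  have hle : μ (p ⁻¹' C) ≤ μ Eᶜ :=
    measure_mono_ae (hEU.mono fun ω hω hωC hωE => hUC (fun g _ => hω hωE g) hωC)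
  rw [hCp, prob_compl_eq_one_sub hEm] at hle
  exact (ENNReal.sub_lt_self ENNReal.one_ne_top one_ne_zero hE.ne').not_ge hle

/-- The thinning sequences of `G` groups for which the first `G` blocks of `k` sticks each are
handed out to the groups in order: group `g` uses every stick of block `g` and none before it. -/
def blockActivations (G k : ℕ) : Set (ℕ → Fin G → ℕ) :=
  {l | ∀ (g : Fin G) (j : ℕ), (j < k * g → l j g = 0) ∧ (k * g ≤ j → j < k * (g + 1) → l j g = 1)}

lemma measurableSet_blockActivations (G k : ℕ) : MeasurableSet (blockActivations G k) := by
  have heq (j : ℕ) (g : Fin G) (i : ℕ) : MeasurableSet {l : ℕ → Fin G → ℕ | l j g = i} :=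
    measurableSet_eq_fun (f := fun l : ℕ → Fin G → ℕ => l j g) (by fun_prop) measurable_const
  simp only [blockActivations, ofPred_forall]
  refine .iInter fun g => .iInter fun j => ?_
  exact (MeasurableSet.const _).imp (heq j g 0) |>.inter <|
    (MeasurableSet.const _).imp <| (MeasurableSet.const _).imp (heq j g 1)

/-- The position of the `i`-th stick of block `g`, for blocks of `k` sticks. -/
def blockIndex {G k : ℕ} (q : Fin G × Fin k) : ℕ :=
  k * q.1 + q.2

lemma injective_blockIndex {G k : ℕ} : (blockIndex : Fin G × Fin k → ℕ).Injective := by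
  have h : (blockIndex : Fin G × Fin k → ℕ) = Fin.val ∘ finProdFinEquiv :=
    funext fun q => add_comm _ _
  exact h ▸ Fin.val_injective.comp finProdFinEquiv.injective

variable {Θ : Type*} [MeasurableSpace Θ]

lemma stickBreaking_mem_of_mem_blockActivations {G k n : ℕ} {l : ℕ → Fin G → ℕ}
    (hl : l ∈ blockActivations G k) (hnk : n ≤ k) {g : Fin G} {c : exhaustingSticks} {v : ℕ → ℝ}
    (hc : (c : ℕ → ℝ) = fun j => v j * l j g) {θ : ℕ → Θ} {U : Set (ProbabilityMeasure Θ)}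
    {V : ℕ → Set ℝ} {T : ℕ → Set Θ}
    (hU : ∀ (c : exhaustingSticks) (θ : ℕ → Θ), (∀ j < n, (c : ℕ → ℝ) j ∈ V j ∧ θ j ∈ T j) →
      stickBreaking c θ ∈ U)
    (hvθ : ∀ i : Fin k, v (blockIndex (g, i)) ∈ V i ∧ θ (blockIndex (g, i)) ∈ T i) :
    stickBreaking c θ ∈ U := by
  have hzero (j : ℕ) (hj : j < k * g) : (c : ℕ → ℝ) j = 0 := by
    simp only [hc, (hl g j).1 hj, Nat.cast_zero, mul_zero]
  rw [stickBreaking_eq_of_forall_lt_eq_zero hzero]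
  refine hU _ _ fun j hj => ?_
  have hjk : j < k := hj.trans_le hnk
  have hone : l (k * g + j) g = 1 :=
    (hl g _).2 (Nat.le_add_right _ _) (by rw [mul_add_one]; exact Nat.add_lt_add_left hjk _)
  have hcj : (c : ℕ → ℝ) (k * g + j) = v (k * g + j) := by
    simp only [hc, hone, Nat.cast_one, mul_one]
  exact hcj ▸ hvθ ⟨j, hjk⟩

variable [TopologicalSpace Θ] [OpensMeasurableSpace Θ]

lemma isWeakSupport_univ_stickBreaking [IsProbabilityMeasure μ] {ν : Measure ℝ}
    (hν : ν.support = Icc 0 1) {P₀ : Measure Θ} (hP₀ : P₀.support = univ) {G : ℕ}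
    {v : ℕ → Ω → ℝ} {θ : ℕ → Ω → Θ} {ℓ : ℕ → Fin G → Ω → ℕ} (hv : IsIID μ ν v)
    (hθ : IsIID μ P₀ θ) (hvθ : IndepFun (fun ω j => v j ω) (fun ω j => θ j ω) μ)
    (hℓ : ∀ j g, Measurable (ℓ j g))
    (hind : IndepFun (fun ω j g => ℓ j g ω) (fun ω => (fun j => v j ω, fun j => θ j ω)) μ)
    (hpos : ∀ k, 0 < μ {ω | (fun j g => ℓ j g ω) ∈ blockActivations G k})
    {c : Ω → Fin G → exhaustingSticks}
    (hc : ∀ᵐ ω ∂μ, ∀ g, (c ω g : ℕ → ℝ) = fun j => v j ω * ℓ j g ω) :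
    IsWeakSupport μ (fun ω g => stickBreaking (c ω g) fun j => θ j ω) univ := by
  refine isWeakSupport_univ_of_forall_isOpen fun U hU => ?_
  choose n V T hV hT hVT using fun g => exists_isOpen_box_stickBreaking_mem (hU g).1 (hU g).2
  let k := Finset.univ.sup n
  let E : Set Ω := (fun ω j g => ℓ j g ω) ⁻¹' blockActivations G k ∩ {ω | ∀ q : Fin G × Fin k,
    v (blockIndex q) ω ∈ V q.1 q.2 ∧ θ (blockIndex q) ω ∈ T q.1 q.2}
  have hv_res : Measurable fun (a : ℕ → ℝ) (q : Fin G × Fin k) => a (blockIndex q) := by fun_prop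
  have hθ_res : Measurable fun (a : ℕ → Θ) (q : Fin G × Fin k) => a (blockIndex q) := by fun_prop
  have hE : 0 < μ E := measure_inter_forall_mem_pos (hv.precomp injective_blockIndex)
    (hθ.precomp injective_blockIndex) (hvθ.comp hv_res hθ_res)
    (hind.comp measurable_id (hv_res.prodMap hθ_res)) (measurableSet_blockActivations G k) (hpos k)
    (fun q => hν ▸ hV q.1 q.2) fun q => by simpa only [hP₀, inter_univ] using hT q.1 q.2
  have hEm : MeasurableSet E := by
    refine MeasurableSet.inter ((measurable_pi_lambda _ fun j =>
      measurable_pi_lambda _ (hℓ j)) (measurableSet_blockActivations G k)) ?_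
    rw [ofPred_forall]
    exact .iInter fun q => (hv.measurable _ (hV q.1 q.2).1.measurableSet).inter
      (hθ.measurable _ (hT q.1 q.2).1.measurableSet)
  refine ⟨E, hEm, hE, hc.mono fun ω hω hωE g => ?_⟩
  exact stickBreaking_mem_of_mem_blockActivations hωE.1 (Finset.le_sup (Finset.mem_univ g)) (hω g)
    (hVT g) fun i => hωE.2 (g, i)

end Support

section ThinnedDDP

variable {Ω Θ : Type*} [MeasurableSpace Ω] [MeasurableSpace Θ] {μ : Measure Ω}

lemma isThinnedDDPVector_iff_ae_eq_stickBreaking {G : ℕ} {v : ℕ → Ω → ℝ} {θ : ℕ → Ω → Θ}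
    {ℓ : ℕ → Fin G → Ω → ℕ} {c : Ω → Fin G → exhaustingSticks}
    (hc : ∀ᵐ ω ∂μ, ∀ g, (c ω g : ℕ → ℝ) = fun j => v j ω * ℓ j g ω)
    {p : Ω → Fin G → ProbabilityMeasure Θ} :
    IsThinnedDDPVector μ v θ ℓ p ↔ p =ᵐ[μ] fun ω g => stickBreaking (c ω g) fun j => θ j ω := by
  refine eventually_congr (hc.mono fun ω hω => ?_)
  rw [funext_iff]
  refine forall_congr' fun g => ?_
  rw [← coe_stickBreaking_eq_thinnedMeasure (hω g)]
  exact Subtype.coe_injective.eq_iff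

variable [TopologicalSpace Θ] [OpensMeasurableSpace Θ]

lemma isWeakSupport_congr_ae {G : ℕ} {p q : Ω → Fin G → ProbabilityMeasure Θ} (hpq : p =ᵐ[μ] q)
    {S : Set (Fin G → ProbabilityMeasure Θ)} : IsWeakSupport μ p S ↔ IsWeakSupport μ q S := by
  have h (C : Set (Fin G → ProbabilityMeasure Θ)) : μ (p ⁻¹' C) = μ (q ⁻¹' C) :=
    measure_congr (hpq.preimage C)
  simp only [IsWeakSupport, h]

lemma measurable_borel_stickBreaking [SecondCountableTopology Θ] {G : ℕ}
    {c : Ω → Fin G → exhaustingSticks} (hc : Measurable c) {θ : Ω → ℕ → Θ} (hθ : Measurable θ) :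
    @Measurable Ω (Fin G → ProbabilityMeasure Θ) _ (borel _)
      fun ω g => stickBreaking (c ω g) (θ ω) := by
  borelize (Fin G → ProbabilityMeasure Θ)
  have hcont : Continuous fun (q : (Fin G → exhaustingSticks) × (ℕ → Θ)) (g : Fin G) =>
      stickBreaking (q.1 g) q.2 :=
    continuous_pi fun g => continuous_stickBreaking (by fun_prop) continuous_snd
  exact Continuous.measurable2 (c := fun a b g => stickBreaking (a g) b) hcont hc hθ

end ThinnedDDP

theorem proposition4_general
    {Ω Θ : Type*} [MeasurableSpace Ω] [TopologicalSpace Θ] [MeasurableSpace Θ]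
    [OpensMeasurableSpace Θ] {μ : Measure Ω} [IsProbabilityMeasure μ]
    {ν : Measure ℝ} (hν : ν.support = Icc 0 1) {P₀ : Measure Θ} (hP₀ : P₀.support = univ) {G : ℕ}
    {v : ℕ → Ω → ℝ} {θ : ℕ → Ω → Θ} {ℓ : ℕ → Fin G → Ω → ℕ}
    (hv : IsIID μ ν v) (hθ : IsIID μ P₀ θ)
    (hvθ : IndepFun (fun ω j => v j ω) (fun ω j => θ j ω) μ) (hℓ : IsThinning μ ℓ)
    (hind : IndepFun (fun ω j g => ℓ j g ω) (fun ω => (fun j => v j ω, fun j => θ j ω)) μ)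
    (hpos : ∀ k, 0 < μ {ω | (fun j g => ℓ j g ω) ∈ blockActivations G k}) :
    (∃ p : Ω → Fin G → ProbabilityMeasure Θ, IsThinnedDDPVector μ v θ ℓ p) ∧
    ∀ p : Ω → Fin G → ProbabilityMeasure Θ, IsThinnedDDPVector μ v θ ℓ p →
      (SecondCountableTopology Θ →
        @AEMeasurable Ω (Fin G → ProbabilityMeasure Θ) (borel _) _ p μ) ∧
      IsWeakSupport μ p univ := by
  obtain ⟨c, hc, hcv⟩ := hℓ.exists_measurable_exhaustingSticks hν hv
    (hind.comp measurable_id measurable_fst)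
  refine ⟨⟨_, (isThinnedDDPVector_iff_ae_eq_stickBreaking hcv).2 .rfl⟩, fun p hp => ?_⟩
  have hpc := (isThinnedDDPVector_iff_ae_eq_stickBreaking hcv).1 hp
  refine ⟨fun _ => ⟨_, measurable_borel_stickBreaking hc
    (measurable_pi_lambda _ hθ.measurable), hpc⟩, ?_⟩
  exact (isWeakSupport_congr_ae hpc).2
    (isWeakSupport_univ_stickBreaking hν hP₀ hv hθ hvθ hℓ.measurable hind hpos hcv)

theorem proposition4
    {Ω Θ : Type*} [MeasurableSpace Ω] [TopologicalSpace Θ] [MeasurableSpace Θ] [BorelSpace Θ]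
    (μ : Measure Ω) [IsProbabilityMeasure μ]
    (α : ℝ) (hα : 0 < α)
    (P₀ : Measure Θ) [IsProbabilityMeasure P₀] (hP₀ : P₀.support = Set.univ)
    (v : ℕ → Ω → ℝ) (θ : ℕ → Ω → Θ) (ℓ : ℕ → Fin 2 → Ω → ℕ)
    (hvθ : IsStickBreaking μ α P₀ v θ)
    (hℓ : IsThinning μ ℓ)
    (hind : IndepFun (fun ω j g => ℓ j g ω) (fun ω => (fun j => v j ω, fun j => θ j ω)) μ)
    (hpos : ∀ k : ℕ, 0 < μ {ω | (∀ j, j < k → ℓ j 0 ω = 1 ∧ ℓ j 1 ω = 0) ∧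
      (∀ j, k ≤ j → j < 2 * k → ℓ j 1 ω = 1)}) :
    -- the series almost surely define probability measures
    (∃ p : Ω → Fin 2 → ProbabilityMeasure Θ, IsThinnedDDPVector μ v θ ℓ p) ∧
    ∀ p : Ω → Fin 2 → ProbabilityMeasure Θ, IsThinnedDDPVector μ v θ ℓ p →
      -- for separable metrizable `Θ`, `p` is a Borel random element
      (TopologicalSpace.SeparableSpace Θ → TopologicalSpace.MetrizableSpace Θ →
        @AEMeasurable Ω (Fin 2 → ProbabilityMeasure Θ) (borel _) _ p μ) ∧
      -- full weak support
      IsWeakSupport μ p Set.univ := by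
  have hblocks (k : ℕ) : 0 < μ {ω | (fun j g => ℓ j g ω) ∈ blockActivations 2 k} :=
    (hpos k).trans_le <| measure_mono fun ω hω => by
      simp only [blockActivations, Fin.forall_fin_two, mem_ofPred_eq] at hω ⊢
      grind
  obtain ⟨hexists, hp⟩ := proposition4_general (support_betaMeasure one_pos hα) hP₀ hvθ.isIID_v
    hvθ.isIID_θ hvθ.indep hℓ hind hblocks
  refine ⟨hexists, fun p hpv => ⟨fun _ _ => (hp p hpv).1 ?_, (hp p hpv).2⟩⟩
  let _ : MetricSpace Θ := TopologicalSpace.metrizableSpaceMetric Θ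
  exact UniformSpace.secondCountable_of_separable Θ
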